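/- Let $I=[0,1]$ and let $f:I\to I$ be $f(x)=2x$ for $0\le x\le 1/2$, $f(x)=2x-1$ for $1/2<x\le 1$. For every $\beta\in(0,1)$ let $g_{1,\beta}$ and $g_{2,\beta}$ be $C^2$ diffeomorphisms of $I$ that fix $0$, $1$ and $\beta$ and satisfy $$g_{1,\beta}(y)<y \ (0<y<\beta),\quad g_{1,\beta}(y)>y\ (\beta<y<1),\qquad g_{2,\beta}(y)>y\ (0<y<\beta),\quad g_{2,\beta}(y)<y\ (\beta<y<1).$$ For $\beta_1,\beta_2\in(0,1)$ let $F_{\beta_1,\beta_2}:I\times I\to I\times I$ be $$F_{\beta_1,\beta_2}(x,y)=\begin{cases}(f(x),g_{1,\beta_1}(y)), & 0\le x\le 1/2,\\ (f(x),g_{2,\beta_2}(y)), & 1/2<x\le 1,\end{cases}$$ and put $A_0=I\times\{0\}$, $A_1=I\times\{1\}$ and $\alpha^j_{\beta_1\beta_2}=g_{1,\beta_1}'(j)\,g_{2,\beta_2}'(j)$ for $j=0,1$. For $\beta_1\in(0,1)$ define the thresholds $$\xi(\beta_1)=\sup\{t\in[0,1]:\ \log\alpha^0_{\beta_1 b}<0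 \text{ for all } b\in(0,1) \text{ with } b<t\},$$ $$\zeta(\beta_1)=\inf\{t\in[0,1]:\ \log\alpha^1_{\beta_1 b}<0 \text{ for all } b\in(0,1) \text{ with } b>t\}$$ (so $\xi(\beta_1)$, resp. $\zeta(\beta_1)$, is the value of $\beta_2$ at which the sign of $\log\alpha^0_{\beta_1\beta_2}$ changes from negative to positive, resp. that of $\log\alpha^1_{\beta_1\beta_2}$ from positive to negative, whenever there is such a value), and let $$\Gamma_G=\{(\beta_1,\beta_2)\in(0,1)^2:\ \zeta(\beta_1)<\beta_2<\xi(\beta_1)\}.$$ Let $m$ be Lebesgue measure on $I\times I$. For a map $F:I\times I\to I\times I$ and $A\subset I\times I$, the basin $\mathcal B(A)$ is the set of points all of whose orbit limit points lie in $A$. A nonempty compact set $A$ with $F(A)=A$ is a *Milnor attractor* if $m(\mathcal B(A))>0$ and no compact proper subset of $A$ has a basin that equals $\mathcal B(A)$ up to a set of measure zero. A Milnor attractor $A$ has a *locally riddled basin* if there is an open neighbourhood $U$ of $A$ such that $m\big(B_\varepsilon(p)\cap(\bigcap_{n\ge0}F^{-n}(U))^c\big)>0$ for all $p\in A$ and $\varepsilon>0$.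 Then for every $(\beta_1,\beta_2)\in\Gamma_G$, both $A_0$ and $A_1$ are Milnor attractors of $F_{\beta_1,\beta_2}$ and have locally riddled basins. -/

import Mathlib

namespace RiddledSkew

open Set Filter Topology MeasureTheory

/-! ### Attractors and basins of a self-map -/

section General

variable {M : Type*}

/-- The omega-limit set of `p`: the set of limit points of the orbit `F^n(p)`, `n ≥ 0`. -/
def omegaSet [TopologicalSpace M] (F : M → M) (p : M) : Set M :=
  {q | MapClusterPt q atTop (fun n : ℕ => F^[n] p)}

/-- The basin of attraction of `A`: the points whose omega-limit set is contained in `A`. -/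
def basin [TopologicalSpace M] (F : M → M) (A : Set M) : Set M :=
  {p | omegaSet F p ⊆ A}

/-- Milnor attractors: nonempty compact invariant sets whose basin has positive measure, and such
that no compact proper subset has the same basin up to a set of measure zero. -/
structure IsMilnorAttractor [TopologicalSpace M] [MeasureSpace M] (F : M → M) (A : Set M) :
    Prop where
  nonempty : A.Nonempty
  isCompact : IsCompact A
  invariant : F '' A = A
  basin_pos : 0 < volume (basin F A)
  minimal : ∀ A' : Set M, IsCompact A' → A' ⊂ A → ¬ (basin F A' =ᵐ[volume] basin F A)

/-- Some open neighbourhood `U` of `A` is such that every ball centred on `A` contains a set of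
positive measure of points whose forward orbit does not stay in `U`. -/
def HasLocallyRiddledBasin [PseudoMetricSpace M] [MeasureSpace M] (F : M → M) (A : Set M) :
    Prop :=
  ∃ U : Set M, IsOpen U ∧ A ⊆ U ∧ ∀ p ∈ A, ∀ ε : ℝ, 0 < ε →
    0 < volume (Metric.ball p ε ∩ (⋂ n : ℕ, F^[n] ⁻¹' U)ᶜ)

end General

/-! ### Diffeomorphisms of the unit interval -/

/-- A self-map of `[0,1]`, seen as a real function (only its values on `[0,1]` matter below). -/
noncomputable def realExt (φ : unitInterval → unitInterval) : ℝ → ℝ :=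
  IccExtend (zero_le_one' ℝ) (fun y => (φ y : ℝ))

/-- `φ` is a `C²` diffeomorphism of `[0,1]` (one-sided derivatives at the end points). -/
def IsC2Diffeo (φ : unitInterval ≃ unitInterval) : Prop :=
  ContDiffOn ℝ 2 (realExt φ) (Icc 0 1) ∧ ContDiffOn ℝ 2 (realExt φ.symm) (Icc 0 1)

/-- The derivative of `φ` at a point of `[0,1]` (one-sided at the end points). -/
noncomputable def fiberDeriv (φ : unitInterval ≃ unitInterval) (y : unitInterval) : ℝ :=
  derivWithin (realExt φ) (Icc 0 1) (y : ℝ)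

/-- First fiber map at the parameter `β`: a `C²` diffeomorphism of `[0,1]` that fixes `0`, `1` and
`β`, lies below the diagonal on `(0, β)` and above it on `(β, 1)`. -/
structure IsFirstFiber (β : ℝ) (φ : unitInterval ≃ unitInterval) : Prop where
  diffeo : IsC2Diffeo φ
  map_zero : φ 0 = 0
  map_one : φ 1 = 1
  map_param : ∀ y : unitInterval, (y : ℝ) = β → φ y = y
  below : ∀ y : unitInterval, 0 < (y : ℝ) → (y : ℝ) < β → φ y < y
  above : ∀ y : unitInterval, β < (y : ℝ) → (y : ℝ) < 1 → y < φ y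

/-- Second fiber map at the parameter `β`: a `C²` diffeomorphism of `[0,1]` that fixes `0`, `1` and
`β`, lies above the diagonal on `(0, β)` and below it on `(β, 1)`. -/
structure IsSecondFiber (β : ℝ) (φ : unitInterval ≃ unitInterval) : Prop where
  diffeo : IsC2Diffeo φ
  map_zero : φ 0 = 0
  map_one : φ 1 = 1
  map_param : ∀ y : unitInterval, (y : ℝ) = β → φ y = y
  above : ∀ y : unitInterval, 0 < (y : ℝ) → (y : ℝ) < β → y < φ y
  below : ∀ y : unitInterval, β < (y : ℝ) → (y : ℝ) < 1 → φ y < y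

/-! ### The skew product -/

/-- The base map `f` of `[0,1]`: `2x` for `x ≤ 1/2`, and `2x - 1` for `x > 1/2`. -/
noncomputable def doubling (x : unitInterval) : unitInterval :=
  if h : (x : ℝ) ≤ 1 / 2 then ⟨2 * (x : ℝ), by have := x.2.1; constructor <;> linarith⟩
  else ⟨2 * (x : ℝ) - 1, by have := x.2.2; constructor <;> linarith⟩

/-- The skew product `F(x, y) = (f(x), g(x, y))` on the unit square, with fiber map `φ₁` over
`[0, 1/2]` and `φ₂` over `(1/2, 1]`. -/
noncomputable def skew (φ₁ φ₂ : unitInterval ≃ unitInterval) (p : unitInterval × unitInterval) :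
    unitInterval × unitInterval :=
  (doubling p.1, if (p.1 : ℝ) ≤ 1 / 2 then φ₁ p.2 else φ₂ p.2)

/-- `A₀ = [0,1] × {0}`. -/
def A₀ : Set (unitInterval × unitInterval) := univ ×ˢ {0}

/-- `A₁ = [0,1] × {1}`. -/
def A₁ : Set (unitInterval × unitInterval) := univ ×ˢ {1}

/-! ### The threshold curves and the region between them -/

/-- `α^j = dg_{1,β₁}(j) · dg_{2,β₂}(j)`; the normal Lyapunov exponent along `[0,1] × {j}` at Lebesgue
almost every point is `(1/2) log α^j`. -/
noncomputable def alpha (g₁ g₂ : ℝ → unitInterval ≃ unitInterval) (j : unitInterval)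
    (β₁ β₂ : ℝ) : ℝ :=
  fiberDeriv (g₁ β₁) j * fiberDeriv (g₂ β₂) j

/-- The threshold `ξ(β₁)`: the largest `t ∈ [0,1]` such that `log α⁰ < 0` for all parameters
`β₂ ∈ (0,1)` below `t`. -/
noncomputable def xi (g₁ g₂ : ℝ → unitInterval ≃ unitInterval) (β₁ : ℝ) : ℝ :=
  sSup {t : ℝ | t ∈ Icc (0 : ℝ) 1 ∧
    ∀ b ∈ Ioo (0 : ℝ) 1, b < t → Real.log (alpha g₁ g₂ 0 β₁ b) < 0}

/-- The threshold `ζ(β₁)`: the smallest `t ∈ [0,1]` such that `log α¹ < 0` for all parameters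
`β₂ ∈ (0,1)` above `t`. -/
noncomputable def zeta (g₁ g₂ : ℝ → unitInterval ≃ unitInterval) (β₁ : ℝ) : ℝ :=
  sInf {t : ℝ | t ∈ Icc (0 : ℝ) 1 ∧
    ∀ b ∈ Ioo (0 : ℝ) 1, t < b → Real.log (alpha g₁ g₂ 1 β₁ b) < 0}

/-- If the sign of `log α⁰` changes from negative to positive at `t` as `β₂` increases, then
`ξ(β₁) = t`. -/
theorem xi_eq_of_sign_change (g₁ g₂ : ℝ → unitInterval ≃ unitInterval) (β₁ t : ℝ)
    (ht : t ∈ Icc (0 : ℝ) 1)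
    (hneg : ∀ b ∈ Ioo (0 : ℝ) 1, b < t → Real.log (alpha g₁ g₂ 0 β₁ b) < 0)
    (hpos : ∀ b ∈ Ioo (0 : ℝ) 1, t < b → 0 < Real.log (alpha g₁ g₂ 0 β₁ b)) :
    xi g₁ g₂ β₁ = t := by
  refine IsGreatest.csSup_eq ⟨⟨ht, hneg⟩, fun s hs => ?_⟩
  by_contra h
  rw [not_le] at h
  obtain ⟨b, hb1, hb2⟩ := exists_between h
  have hb : b ∈ Ioo (0 : ℝ) 1 := ⟨lt_of_le_of_lt ht.1 hb1, lt_of_lt_of_le hb2 hs.1.2⟩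
  exact lt_asymm (hs.2 b hb hb2) (hpos b hb hb1)

/-- If the sign of `log α¹` changes from positive to negative at `t` as `β₂` increases, then
`ζ(β₁) = t`. -/
theorem zeta_eq_of_sign_change (g₁ g₂ : ℝ → unitInterval ≃ unitInterval) (β₁ t : ℝ)
    (ht : t ∈ Icc (0 : ℝ) 1)
    (hpos : ∀ b ∈ Ioo (0 : ℝ) 1, b < t → 0 < Real.log (alpha g₁ g₂ 1 β₁ b))
    (hneg : ∀ b ∈ Ioo (0 : ℝ) 1, t < b → Real.log (alpha g₁ g₂ 1 β₁ b) < 0) :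
    zeta g₁ g₂ β₁ = t := by
  refine IsLeast.csInf_eq ⟨⟨ht, hneg⟩, fun s hs => ?_⟩
  by_contra h
  rw [not_le] at h
  obtain ⟨b, hb1, hb2⟩ := exists_between h
  have hb : b ∈ Ioo (0 : ℝ) 1 := ⟨lt_of_le_of_lt hs.1.1 hb1, lt_of_lt_of_le hb2 ht.2⟩
  exact lt_asymm (hs.2 b hb hb1) (hpos b hb hb2)

/-- The region `Γ_G` of the parameter square between the two threshold curves. -/
def GammaG (g₁ g₂ : ℝ → unitInterval ≃ unitInterval) : Set (ℝ × ℝ) :=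
  {b | b.1 ∈ Ioo (0 : ℝ) 1 ∧ b.2 ∈ Ioo (0 : ℝ) 1 ∧
    zeta g₁ g₂ b.1 < b.2 ∧ b.2 < xi g₁ g₂ b.1}

end RiddledSkew

/-! Fix a boundary line `univ ×ˢ {j}`. Membership in `GammaG` makes `log α^j` negative at both `j =
0` and `j = 1`, so both lines can be treated alike.

Attraction. Near `j` the two fiber maps are Lipschitz towards `j` with constants slightly above the
absolute values of their derivatives, still with product below 1. Along an orbit these constants
multiply according to the binary itinerary. For small `s > 0` the sum of their `s`-th powers is
below 2, so the `s`-th powers of the products have geometrically decaying integrals. Hence the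
products tend to 0 almost everywhere, with no ergodic theorem (`ae_tendsto_prod_itinerary`). They
are bounded by a constant on a set of positive measure, over which a whole strip next to the line is
attracted (`volume_basin_pos`).

Minimality. Almost every base orbit accumulates everywhere (`ae_forall_mapClusterPt_doubling`), so
almost every point of the basin has the whole line as its omega-limit set.

Riddling. The second fiber map repels from both ends. Prescribing a long run of second-branch digits
after any initial word drives an open set of heights out of a fixed neighbourhood
(`hasLocallyRiddledBasin_horizontal`). -/

namespace RiddledSkew

open Set Filter Topology MeasureTheory

/-! ### Measure theory of the doubling map -/

/-- The two branch domains of the doubling map: `[0, 1/2]` for `true`, `(1/2, 1]` for `false`. -/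
def branch (b : Bool) : Set unitInterval := {x | decide ((x : ℝ) ≤ 1 / 2) = b}

theorem mem_branch_true {x : unitInterval} : x ∈ branch true ↔ (x : ℝ) ≤ 1 / 2 := by
  simp [branch]

theorem mem_branch_false {x : unitInterval} : x ∈ branch false ↔ 1 / 2 < (x : ℝ) := by
  simp [branch]

theorem doubling_coe_of_le {x : unitInterval} (h : (x : ℝ) ≤ 1 / 2) :
    (doubling x : ℝ) = 2 * x := by
  unfold doubling; rw [dif_pos h]

theorem doubling_coe_of_lt {x : unitInterval} (h : 1 / 2 < (x : ℝ)) :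
    (doubling x : ℝ) = 2 * x - 1 := by
  unfold doubling; rw [dif_neg (not_le.2 h)]

theorem measurableSet_branch (b : Bool) : MeasurableSet (branch b) := by
  have h : MeasurableSet {x : unitInterval | (x : ℝ) ≤ 1 / 2} :=
    measurableSet_le measurable_subtype_coe measurable_const
  cases b
  · convert h.compl using 1
    ext x
    simp [mem_branch_false]
  · convert h using 1
    ext x
    simp [mem_branch_true]

theorem measurable_doubling : Measurable doubling := by
  have h : MeasurableSet {x : unitInterval | (x : ℝ) ≤ 1 / 2} :=
    measurableSet_le measurable_subtype_coe measurable_const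
  refine (MeasurableEmbedding.subtype_coe measurableSet_Icc).measurable_comp_iff.1 ?_
  have : Subtype.val ∘ doubling =
      fun x : unitInterval => if (x : ℝ) ≤ 1 / 2 then 2 * (x : ℝ) else 2 * x - 1 := by
    ext x
    split_ifs with hx
    · exact doubling_coe_of_le hx
    · exact doubling_coe_of_lt (not_le.1 hx)
  rw [this]
  exact Measurable.ite h (by fun_prop) (by fun_prop)

theorem image_branch_true_inter_preimage (S : Set unitInterval) :
    (Subtype.val '' (branch true ∩ doubling ⁻¹' S) : Set ℝ) =
      (fun x : ℝ => 2 * x) ⁻¹' (Subtype.val '' S) := by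
  ext x
  constructor
  · rintro ⟨x, ⟨hx, hS⟩, rfl⟩
    exact ⟨doubling x, hS, doubling_coe_of_le (mem_branch_true.1 hx)⟩
  · rintro ⟨s, hs, hsx⟩
    have h0 := s.2.1
    have h1 := s.2.2
    simp only at hsx
    have hx : x ∈ Icc (0 : ℝ) 1 := ⟨by linarith, by linarith⟩
    have hx2 : ((⟨x, hx⟩ : unitInterval) : ℝ) ≤ 1 / 2 := by simp only; linarith
    refine ⟨⟨x, hx⟩, ⟨mem_branch_true.2 hx2, ?_⟩, rfl⟩
    have : doubling ⟨x, hx⟩ = s := Subtype.ext (by rw [doubling_coe_of_le hx2]; exact hsx.symm)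
    rwa [mem_preimage, this]

/-- The formula `2x - 1` also makes sense at `1/2`, but that point belongs to the first branch and
has to be removed; being a single point, it does not affect measures. -/
theorem image_branch_false_inter_preimage (S : Set unitInterval) :
    (Subtype.val '' (branch false ∩ doubling ⁻¹' S) : Set ℝ) =
      ((fun x : ℝ => 2 * x) ⁻¹' ((fun x : ℝ => x + -1) ⁻¹' (Subtype.val '' S))) \ {1 / 2} := by
  ext x
  constructor
  · rintro ⟨x, ⟨hx, hS⟩, rfl⟩
    rw [mem_branch_false] at hx
    refine ⟨⟨doubling x, hS, ?_⟩, hx.ne'⟩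
    rw [doubling_coe_of_lt hx]
    ring
  · rintro ⟨⟨s, hs, hsx⟩, hne⟩
    have h0 := s.2.1
    have h1 := s.2.2
    simp only at hsx
    have hx : x ∈ Icc (0 : ℝ) 1 := ⟨by linarith, by linarith⟩
    have hx2 : 1 / 2 < ((⟨x, hx⟩ : unitInterval) : ℝ) :=
      lt_of_le_of_ne (by simp only; linarith) (fun h => hne h.symm)
    refine ⟨⟨x, hx⟩, ⟨mem_branch_false.2 hx2, ?_⟩, rfl⟩
    have : doubling ⟨x, hx⟩ = s :=
      Subtype.ext (by rw [doubling_coe_of_lt hx2]; simp only; linarith)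
    rwa [mem_preimage, this]

/-- Each branch of the doubling map halves Lebesgue measure. -/
theorem volume_branch_inter_preimage (b : Bool) (S : Set unitInterval) :
    volume (branch b ∩ doubling ⁻¹' S) = 2⁻¹ * volume S := by
  have h2 : ENNReal.ofReal |(2 : ℝ)⁻¹| = 2⁻¹ := by
    rw [abs_of_pos (by norm_num), ENNReal.ofReal_inv_of_pos (by norm_num), ENNReal.ofReal_ofNat]
  rw [unitInterval.volume_apply, unitInterval.volume_apply]
  cases b
  · rw [image_branch_false_inter_preimage, measure_sdiff_null Real.volume_singleton,
      Real.volume_preimage_mul_left two_ne_zero, measure_preimage_add_right, h2]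
  · rw [image_branch_true_inter_preimage, Real.volume_preimage_mul_left two_ne_zero, h2]

theorem branch_union : branch true ∪ branch false = univ := by
  ext x
  simp [mem_branch_true, mem_branch_false, le_or_gt]

theorem disjoint_branch : Disjoint (branch true) (branch false) := by
  rw [Set.disjoint_left]
  intro x hx hx'
  rw [mem_branch_true] at hx
  rw [mem_branch_false] at hx'
  exact absurd hx (not_le.2 hx')

theorem map_doubling_restrict_branch (b : Bool) :
    (volume.restrict (branch b)).map doubling = (2⁻¹ : ENNReal) • volume := by
  ext S hS
  rw [Measure.map_apply measurable_doubling hS,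
    Measure.restrict_apply (measurable_doubling hS), inter_comm, volume_branch_inter_preimage,
    Measure.smul_apply, smul_eq_mul]

theorem lintegral_branch_comp_doubling (b : Bool) {v : unitInterval → ENNReal}
    (hv : Measurable v) : ∫⁻ x in branch b, v (doubling x) = 2⁻¹ * ∫⁻ x, v x := by
  rw [← lintegral_map hv measurable_doubling, map_doubling_restrict_branch,
    lintegral_smul_measure, smul_eq_mul]

theorem measurePreserving_doubling : MeasurePreserving doubling volume volume := by
  refine ⟨measurable_doubling, ?_⟩
  ext S hS
  rw [Measure.map_apply measurable_doubling hS, ← univ_inter (doubling ⁻¹' S), ← branch_union,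
    union_inter_distrib_right, measure_union (disjoint_branch.mono inter_subset_left
      inter_subset_left) ((measurableSet_branch _).inter (measurable_doubling hS)),
    volume_branch_inter_preimage, volume_branch_inter_preimage, ← add_mul,
    ENNReal.inv_two_add_inv_two, one_mul]

/-- The points whose itinerary under the doubling map starts with the given word. -/
def cylinder : List Bool → Set unitInterval
  | [] => univ
  | b :: w => branch b ∩ doubling ⁻¹' cylinder w

theorem measurableSet_cylinder (w : List Bool) : MeasurableSet (cylinder w) := by
  induction w with
  | nil => exact MeasurableSet.univ
  | cons b w ih => exact (measurableSet_branch b).inter (measurable_doubling ih)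

theorem volume_cylinder_inter_preimage (w : List Bool) (S : Set unitInterval) :
    volume (cylinder w ∩ doubling^[w.length] ⁻¹' S) = 2⁻¹ ^ w.length * volume S := by
  induction w with
  | nil => simp [cylinder]
  | cons b w ih =>
    have : cylinder (b :: w) ∩ doubling^[(b :: w).length] ⁻¹' S =
        branch b ∩ doubling ⁻¹' (cylinder w ∩ doubling^[w.length] ⁻¹' S) := by
      simp only [cylinder, List.length_cons, Function.iterate_succ, preimage_inter, preimage_comp,
        inter_assoc]
    rw [this, volume_branch_inter_preimage, ih, List.length_cons, pow_succ', mul_assoc]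

theorem volume_cylinder (w : List Bool) : volume (cylinder w) = 2⁻¹ ^ w.length := by
  simpa using volume_cylinder_inter_preimage w univ

theorem volume_cylinder_pos (w : List Bool) : 0 < volume (cylinder w) := by
  rw [volume_cylinder]
  exact ENNReal.pow_pos (by simp) _

/-- The first `n` digits of the itinerary of `x`. -/
noncomputable def itinerary : ℕ → unitInterval → List Bool
  | 0, _ => []
  | n + 1, x => decide ((x : ℝ) ≤ 1 / 2) :: itinerary n (doubling x)

theorem mem_cylinder_itinerary (n : ℕ) (x : unitInterval) : x ∈ cylinder (itinerary n x) := by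
  induction n generalizing x with
  | zero => exact mem_univ x
  | succ n ih => exact ⟨rfl, ih _⟩

theorem length_itinerary (n : ℕ) (x : unitInterval) : (itinerary n x).length = n := by
  induction n generalizing x with
  | zero => rfl
  | succ n ih => simp [itinerary, ih]

theorem dist_le_of_mem_cylinder {w : List Bool} {x x' : unitInterval} (hx : x ∈ cylinder w)
    (hx' : x' ∈ cylinder w) : dist x x' ≤ 2⁻¹ ^ w.length := by
  induction w generalizing x x' with
  | nil =>
    rw [Subtype.dist_eq, Real.dist_eq, abs_le]
    have := x.2.1; have := x.2.2; have := x'.2.1; have := x'.2.2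
    constructor <;> simp <;> linarith
  | cons b w ih =>
    have h := ih hx.2 hx'.2
    have key : dist (doubling x) (doubling x') = 2 * dist x x' := by
      simp only [Subtype.dist_eq, Real.dist_eq]
      have h2 (a : ℝ) : 2 * |a| = |2 * a| := by rw [abs_mul, abs_two]
      rw [h2]
      congr 1
      cases b
      · rw [doubling_coe_of_lt (mem_branch_false.1 hx.1),
          doubling_coe_of_lt (mem_branch_false.1 hx'.1)]
        ring
      · rw [doubling_coe_of_le (mem_branch_true.1 hx.1),
          doubling_coe_of_le (mem_branch_true.1 hx'.1)]
        ring
    rw [List.length_cons, pow_succ]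
    linarith

/-- Cylinders replace balls: there are only countably many, so almost-everywhere statements about
each one hold simultaneously, and their measures are explicit. -/
theorem exists_cylinder_subset {U : Set unitInterval} {x : unitInterval} (hU : U ∈ 𝓝 x) :
    ∃ w, x ∈ cylinder w ∧ cylinder w ⊆ U := by
  obtain ⟨ε, hε, hball⟩ := Metric.mem_nhds_iff.1 hU
  obtain ⟨n, hn⟩ := exists_pow_lt_of_lt_one hε (by norm_num : (2⁻¹ : ℝ) < 1)
  refine ⟨itinerary n x, mem_cylinder_itinerary n x, fun x' hx' => hball ?_⟩
  have := dist_le_of_mem_cylinder hx' (mem_cylinder_itinerary n x)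
  rw [length_itinerary] at this
  exact this.trans_lt hn

theorem volume_pos_of_mem_nhds {U : Set unitInterval} {x : unitInterval} (hU : U ∈ 𝓝 x) :
    0 < volume U := by
  obtain ⟨w, -, hw⟩ := exists_cylinder_subset hU
  exact (volume_cylinder_pos w).trans_le (measure_mono hw)

/-- Let `E` be the set of points that never visit the cylinder, and `k` the word length. The
preimage of `E` under `k` steps contains `E` and, disjointly, a part of the cylinder of measure
`2⁻ᵏ` times that of `E`. Since measure is preserved, `E` is null. -/
theorem ae_exists_iterate_mem_cylinder (w : List Bool) :
    ∀ᵐ x : unitInterval, ∃ n, doubling^[n] x ∈ cylinder w := by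
  set E : Set unitInterval := {x | ¬ ∃ n, doubling^[n] x ∈ cylinder w} with hE
  set k := w.length
  have hmeas : MeasurableSet E := by
    have : E = ⋂ n, (doubling^[n] ⁻¹' cylinder w)ᶜ := by ext x; simp [hE]
    rw [this]
    exact MeasurableSet.iInter fun n =>
      ((measurable_doubling.iterate n) (measurableSet_cylinder w)).compl
  have hsub : E ∪ (cylinder w ∩ doubling^[k] ⁻¹' E) ⊆ doubling^[k] ⁻¹' E := by
    rintro x (hx | hx)
    · rintro ⟨n, hn⟩
      exact hx ⟨n + k, by rwa [Function.iterate_add_apply]⟩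
    · exact hx.2
  have hdisj : Disjoint E (cylinder w ∩ doubling^[k] ⁻¹' E) := by
    rw [Set.disjoint_left]
    exact fun x hx hx' => hx ⟨0, hx'.1⟩
  have hle : volume E + 2⁻¹ ^ k * volume E ≤ volume E + 0 := by
    rw [add_zero]
    calc volume E + 2⁻¹ ^ k * volume E
        = volume (E ∪ (cylinder w ∩ doubling^[k] ⁻¹' E)) := by
          rw [measure_union hdisj ((measurableSet_cylinder w).inter
            ((measurable_doubling.iterate k) hmeas)), volume_cylinder_inter_preimage]
      _ ≤ volume (doubling^[k] ⁻¹' E) := measure_mono hsub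
      _ = volume E :=
          (measurePreserving_doubling.iterate k).measure_preimage hmeas.nullMeasurableSet
  have h0 := (ENNReal.add_le_add_iff_left (measure_ne_top volume E)).1 hle
  rw [nonpos_iff_eq_zero, mul_eq_zero] at h0
  exact h0.resolve_left (pow_ne_zero _ (by simp))

/-- Every point of the interval is a limit point of the orbit of almost every point. -/
theorem ae_forall_mapClusterPt_doubling :
    ∀ᵐ x : unitInterval, ∀ q, MapClusterPt q atTop (fun n : ℕ => doubling^[n] x) := by
  have h : ∀ᵐ x : unitInterval, ∀ (w : List Bool) (m : ℕ),
      ∃ n, doubling^[n] (doubling^[m] x) ∈ cylinder w := by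
    refine ae_all_iff.2 fun w => ae_all_iff.2 fun m => ?_
    exact (measurePreserving_doubling.iterate m).quasiMeasurePreserving.ae
      (ae_exists_iterate_mem_cylinder w)
  filter_upwards [h] with x hx q
  rw [mapClusterPt_iff_frequently]
  intro U hU
  obtain ⟨w, -, hw⟩ := exists_cylinder_subset hU
  rw [frequently_atTop]
  intro m
  obtain ⟨n, hn⟩ := hx w m
  rw [← Function.iterate_add_apply] at hn
  exact ⟨n + m, Nat.le_add_left m n, hw hn⟩

/-! ### Multiplicative cocycles over the doubling map -/

theorem measurable_prod_itinerary (d : Bool → ENNReal) (n : ℕ) :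
    Measurable fun x => ((itinerary n x).map d).prod := by
  induction n with
  | zero => exact measurable_const
  | succ n ih =>
    have h : MeasurableSet {x : unitInterval | (x : ℝ) ≤ 1 / 2} :=
      measurableSet_le measurable_subtype_coe measurable_const
    have h' : Measurable fun x : unitInterval => decide ((x : ℝ) ≤ 1 / 2) := by
      refine measurable_to_bool ?_
      convert h using 1
      ext x
      simp
    simp only [itinerary, List.map_cons, List.prod_cons]
    exact ((measurable_of_finite d).comp h').mul (ih.comp measurable_doubling)

theorem setLIntegral_branch_prod_itinerary (d : Bool → ENNReal) (n : ℕ) (b : Bool) :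
    ∫⁻ x in branch b, ((itinerary (n + 1) x).map d).prod =
      2⁻¹ * d b * ∫⁻ x, ((itinerary n x).map d).prod := by
  have h : ∀ x ∈ branch b, ((itinerary (n + 1) x).map d).prod =
      d b * ((itinerary n (doubling x)).map d).prod := by
    rintro x rfl
    rfl
  rw [setLIntegral_congr_fun (measurableSet_branch b) h,
    lintegral_const_mul (d b) (f := fun x => ((itinerary n (doubling x)).map d).prod)
      ((measurable_prod_itinerary d n).comp measurable_doubling),
    lintegral_branch_comp_doubling b (measurable_prod_itinerary d n)]
  ring

theorem lintegral_prod_itinerary (d : Bool → ENNReal) (n : ℕ) :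
    ∫⁻ x, ((itinerary n x).map d).prod = (2⁻¹ * (d true + d false)) ^ n := by
  induction n with
  | zero => simp [itinerary]
  | succ n ih =>
    rw [← setLIntegral_univ, ← branch_union, lintegral_union (measurableSet_branch _)
      disjoint_branch, setLIntegral_branch_prod_itinerary, setLIntegral_branch_prod_itinerary, ih]
    ring

/-- The integrals form a convergent geometric series, so the sum of the products is finite almost
everywhere and its terms tend to 0. -/
theorem ae_tendsto_prod_itinerary_of_add_lt_two {d : Bool → ENNReal}
    (hd : d true + d false < 2) :
    ∀ᵐ x : unitInterval, Tendsto (fun n => ((itinerary n x).map d).prod) atTop (𝓝 0) := by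
  have hlt : 2⁻¹ * (d true + d false) < 1 := by
    rw [mul_comm, ← div_eq_mul_inv]
    exact ENNReal.div_lt_of_lt_mul (by rwa [one_mul])
  have hfin : ∫⁻ x : unitInterval, ∑' n, ((itinerary n x).map d).prod ≠ ⊤ := by
    rw [lintegral_tsum fun n => (measurable_prod_itinerary d n).aemeasurable]
    simp only [lintegral_prod_itinerary, ENNReal.tsum_geometric]
    exact ENNReal.inv_ne_top.2 (tsub_pos_of_lt hlt).ne'
  filter_upwards [ae_lt_top (Measurable.tsum fun n => measurable_prod_itinerary d n) hfin]
    with x hx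
  exact ENNReal.tendsto_atTop_zero_of_tsum_ne_top hx.ne

/-- At `s = 0` the sum equals 2 and has derivative `log (a * b) < 0`. -/
theorem exists_rpow_add_rpow_lt_two {a b : ℝ} (ha : 0 < a) (hb : 0 < b) (hab : a * b < 1) :
    ∃ s : ℝ, 0 < s ∧ a ^ s + b ^ s < 2 := by
  have hder : HasDerivAt (fun s : ℝ => a ^ s + b ^ s) (Real.log a + Real.log b) 0 := by
    have h1 := (Real.hasStrictDerivAt_const_rpow ha 0).hasDerivAt
    have h2 := (Real.hasStrictDerivAt_const_rpow hb 0).hasDerivAt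
    have h3 := h1.add h2
    rw [Real.rpow_zero, Real.rpow_zero, one_mul, one_mul] at h3
    exact h3
  have hneg : Real.log a + Real.log b < 0 := by
    rw [← Real.log_mul ha.ne' hb.ne']
    exact Real.log_neg (mul_pos ha hb) hab
  have hev := ((hasDerivAt_iff_tendsto_slope.1 hder).mono_left
    (nhdsWithin_mono _ fun s (hs : 0 < s) => hs.ne' : 𝓝[>] (0 : ℝ) ≤ 𝓝[≠] 0)).eventually_lt_const
    hneg
  obtain ⟨s, hs, hs0⟩ := (hev.and self_mem_nhdsWithin).exists
  have hs0 : 0 < s := hs0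
  refine ⟨s, hs0, ?_⟩
  rw [slope_def_field, div_neg_iff] at hs
  simp at hs
  rcases hs with hs | hs <;> linarith

/-- A two-valued multiplicative cocycle over the doubling map tends to zero almost everywhere if
the product of its values is less than one. -/
theorem ae_tendsto_prod_itinerary {c : Bool → NNReal} (hc : ∀ b, 0 < c b)
    (h : c true * c false < 1) :
    ∀ᵐ x : unitInterval, Tendsto (fun n => ((itinerary n x).map c).prod) atTop (𝓝 0) := by
  obtain ⟨s, hs, hlt⟩ := exists_rpow_add_rpow_lt_two (a := c true) (b := c false) (hc true)
    (hc false) (by exact_mod_cast h)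
  have hprod (w : List Bool) :
      ((w.map c).prod : ENNReal) = ((w.map fun b => ((c b ^ s : NNReal) : ENNReal)).prod) ^ s⁻¹ := by
    induction w with
    | nil => simp
    | cons b w ih =>
      rw [List.map_cons, List.prod_cons, List.map_cons, List.prod_cons, ENNReal.coe_mul, ih,
        ENNReal.mul_rpow_of_nonneg _ _ (inv_nonneg.2 hs.le),
        ENNReal.coe_rpow_of_nonneg _ hs.le, ENNReal.rpow_rpow_inv hs.ne']
  have hlt' : ((c true ^ s : NNReal) : ENNReal) + ((c false ^ s : NNReal) : ENNReal) < 2 := by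
    have : c true ^ s + c false ^ s < 2 := by
      rw [← NNReal.coe_lt_coe]
      push_cast
      exact hlt
    exact_mod_cast this
  filter_upwards [ae_tendsto_prod_itinerary_of_add_lt_two
    (d := fun b => ((c b ^ s : NNReal) : ENNReal)) hlt'] with x hx
  have h1 := ((ENNReal.continuous_rpow_const (y := s⁻¹)).tendsto 0).comp hx
  rw [ENNReal.zero_rpow_of_pos (inv_pos.2 hs)] at h1
  rw [← ENNReal.tendsto_coe]
  refine h1.congr fun n => ?_
  exact (hprod _).symm

/-! ### Iterates of the skew product -/

/-- The composition of fiber maps along a word, the first letter acting first. -/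
def fiberWord (φ₁ φ₂ : unitInterval ≃ unitInterval) : List Bool → unitInterval → unitInterval
  | [], y => y
  | b :: w, y => fiberWord φ₁ φ₂ w (cond b φ₁ φ₂ y)

variable {φ₁ φ₂ : unitInterval ≃ unitInterval} {j : unitInterval}

theorem skew_of_mem_branch {b : Bool} {x : unitInterval} (hx : x ∈ branch b) (y : unitInterval) :
    skew φ₁ φ₂ (x, y) = (doubling x, cond b φ₁ φ₂ y) := by
  cases b
  · simp only [skew, if_neg (not_le.2 (mem_branch_false.1 hx)), cond_false]
  · simp only [skew, if_pos (mem_branch_true.1 hx), cond_true]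

theorem skew_iterate_of_mem_cylinder {w : List Bool} {x : unitInterval} (hx : x ∈ cylinder w)
    (y : unitInterval) :
    (skew φ₁ φ₂)^[w.length] (x, y) = (doubling^[w.length] x, fiberWord φ₁ φ₂ w y) := by
  induction w generalizing x y with
  | nil => rfl
  | cons b w ih =>
    rw [List.length_cons, Function.iterate_succ_apply, skew_of_mem_branch hx.1, ih hx.2,
      Function.iterate_succ_apply]
    rfl

theorem skew_iterate (n : ℕ) (x y : unitInterval) :
    (skew φ₁ φ₂)^[n] (x, y) = (doubling^[n] x, fiberWord φ₁ φ₂ (itinerary n x) y) := by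
  have := skew_iterate_of_mem_cylinder (φ₁ := φ₁) (φ₂ := φ₂) (mem_cylinder_itinerary n x) y
  rwa [length_itinerary] at this

theorem cylinder_append_subset (v w : List Bool) : cylinder (v ++ w) ⊆ cylinder v := by
  induction v with
  | nil => exact subset_univ _
  | cons b v ih => exact fun z hz => ⟨hz.1, ih hz.2⟩

theorem fiberWord_append (v w : List Bool) (y : unitInterval) :
    fiberWord φ₁ φ₂ (v ++ w) y = fiberWord φ₁ φ₂ w (fiberWord φ₁ φ₂ v y) := by
  induction v generalizing y with
  | nil => rfl
  | cons b v ih => exact ih _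

theorem fiberWord_replicate_false (n : ℕ) (y : unitInterval) :
    fiberWord φ₁ φ₂ (List.replicate n false) y = φ₂^[n] y := by
  induction n generalizing y with
  | zero => rfl
  | succ n ih => exact ih _

theorem continuous_fiberWord (h₁ : Continuous φ₁) (h₂ : Continuous φ₂) (w : List Bool) :
    Continuous (fiberWord φ₁ φ₂ w) := by
  induction w with
  | nil => exact continuous_id
  | cons b w ih => cases b <;> exact ih.comp ‹_›

theorem injective_fiberWord (w : List Bool) : Function.Injective (fiberWord φ₁ φ₂ w) := by
  induction w with
  | nil => exact Function.injective_id
  | cons b w ih => exact ih.comp (Equiv.injective _)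

theorem fiberWord_fixed (h₁ : φ₁ j = j) (h₂ : φ₂ j = j) (w : List Bool) :
    fiberWord φ₁ φ₂ w j = j := by
  induction w with
  | nil => rfl
  | cons b w ih => cases b <;> simp [fiberWord, h₁, h₂, ih]

theorem doubling_surjective : Function.Surjective doubling := by
  intro x
  have h : (x : ℝ) / 2 ∈ Icc (0 : ℝ) 1 := ⟨by linarith [x.2.1], by linarith [x.2.2]⟩
  refine ⟨⟨x / 2, h⟩, Subtype.ext ?_⟩
  rw [doubling_coe_of_le (by simp only; linarith [x.2.2])]
  simp only
  ring

theorem skew_image_horizontal (h₁ : φ₁ j = j) (h₂ : φ₂ j = j) :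
    skew φ₁ φ₂ '' (univ ×ˢ {j}) = univ ×ˢ {j} := by
  ext ⟨x, y⟩
  constructor
  · rintro ⟨⟨x', y'⟩, ⟨-, rfl⟩, h⟩
    refine ⟨mem_univ _, ?_⟩
    rw [← h]
    simp [skew, h₁, h₂]
  · rintro ⟨-, rfl⟩
    obtain ⟨x', rfl⟩ := doubling_surjective x
    exact ⟨(x', y), ⟨mem_univ _, rfl⟩, by simp_all [skew]⟩

/-! ### The basin of a horizontal boundary -/

/-- The local estimate `hc` is usable only within distance `δ`. The hypothesis on all partial
products keeps the orbit there, and it passes to the next point of the orbit, which is what the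
induction needs. -/
theorem dist_fiberWord_itinerary_le {c : Bool → NNReal} {δ : ℝ}
    (hc : ∀ b y, dist y j < δ → dist (cond b φ₁ φ₂ y) j ≤ c b * dist y j) (n : ℕ)
    {x y : unitInterval} (h : ∀ m, (((itinerary m x).map c).prod : ℝ) * dist y j < δ) :
    dist (fiberWord φ₁ φ₂ (itinerary n x) y) j ≤ ((itinerary n x).map c).prod * dist y j := by
  induction n generalizing x y with
  | zero => simp [itinerary, fiberWord]
  | succ n ih =>
    set b := decide ((x : ℝ) ≤ 1 / 2) with hb
    have hstep : dist (cond b φ₁ φ₂ y) j ≤ c b * dist y j :=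
      hc b y (by simpa [itinerary] using h 0)
    have hmul (m : ℕ) : (((itinerary m (doubling x)).map c).prod : ℝ) * dist (cond b φ₁ φ₂ y) j ≤
        ((itinerary (m + 1) x).map c).prod * dist y j := by
      simp only [itinerary, List.map_cons, List.prod_cons, NNReal.coe_mul, ← hb]
      calc _ ≤ (((itinerary m (doubling x)).map c).prod : ℝ) * (c b * dist y j) := by gcongr
        _ = _ := by ring
    exact (ih fun m => (hmul m).trans_lt (h (m + 1))).trans (hmul n)

theorem mem_basin_of_tendsto {x y : unitInterval}
    (h : Tendsto (fun n => fiberWord φ₁ φ₂ (itinerary n x) y) atTop (𝓝 j)) :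
    (x, y) ∈ basin (skew φ₁ φ₂) (univ ×ˢ {j}) := by
  intro q hq
  refine ⟨mem_univ _, ?_⟩
  obtain ⟨u, hu, hlim⟩ := mapClusterPt_iff_ultrafilter.1 hq
  simp only [skew_iterate] at hlim
  exact tendsto_nhds_unique ((continuous_snd.tendsto q).comp hlim) (h.mono_left hu)

theorem volume_basin_pos {c : Bool → NNReal} {δ : ℝ} (hδ : 0 < δ) (hpos : ∀ b, 0 < c b)
    (hlt : c true * c false < 1)
    (hc : ∀ b y, dist y j < δ → dist (cond b φ₁ φ₂ y) j ≤ c b * dist y j) :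
    0 < volume (basin (skew φ₁ φ₂) (univ ×ˢ {j})) := by
  let G (k : ℕ) : Set unitInterval := {x |
    Tendsto (fun n => ((itinerary n x).map c).prod) atTop (𝓝 0) ∧
      ∀ n, ((itinerary n x).map c).prod ≤ k}
  have hG : ∃ k, volume (G k) ≠ 0 := by
    by_contra! hall
    have h0 : ∀ᵐ x : unitInterval, x ∉ ⋃ k, G k := measure_eq_zero_iff_ae_notMem.1
      (measure_iUnion_null hall)
    obtain ⟨x, hx, hx'⟩ := (h0.and (ae_tendsto_prod_itinerary hpos hlt)).exists
    obtain ⟨B, hB⟩ := hx'.bddAbove_range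
    obtain ⟨k, hk⟩ := exists_nat_ge B
    exact hx (mem_iUnion.2 ⟨k, hx', fun n => (hB (mem_range_self n)).trans hk⟩)
  obtain ⟨k, hk⟩ := hG
  -- Dividing by `k + 1` keeps the radius meaningful when `k = 0`; products bounded by `k` then
  -- never carry a point beyond distance `δ`.
  have hsub : G k ×ˢ Metric.ball j (δ / (k + 1)) ⊆ basin (skew φ₁ φ₂) (univ ×ˢ {j}) := by
    rintro ⟨x, y⟩ ⟨⟨hx, hxk⟩, hy⟩
    have hk1 : (0 : ℝ) < k + 1 := by positivity
    rw [Metric.mem_ball, lt_div_iff₀ hk1] at hy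
    have hbound (m : ℕ) : (((itinerary m x).map c).prod : ℝ) * dist y j < δ := by
      have : (((itinerary m x).map c).prod : ℝ) ≤ k := by exact_mod_cast hxk m
      nlinarith [dist_nonneg (x := y) (y := j)]
    refine mem_basin_of_tendsto (tendsto_iff_dist_tendsto_zero.2 ?_)
    refine squeeze_zero (fun _ => dist_nonneg)
      (fun n => dist_fiberWord_itinerary_le hc n hbound) ?_
    have := (NNReal.tendsto_coe.2 hx).mul_const (dist y j)
    simpa using this
  refine lt_of_lt_of_le ?_ (measure_mono hsub)
  rw [Measure.volume_eq_prod, Measure.prod_prod]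
  exact ENNReal.mul_pos hk
    (volume_pos_of_mem_nhds (Metric.ball_mem_nhds j (by positivity))).ne'

/-- Along an ultrafilter that takes the base orbit to `q`, compactness makes the heights converge
too. The limit pair is in the omega-limit set, so its height must be `j`. -/
theorem subset_omegaSet {x y : unitInterval}
    (hx : ∀ q, MapClusterPt q atTop (fun n : ℕ => doubling^[n] x))
    (hxy : (x, y) ∈ basin (skew φ₁ φ₂) (univ ×ˢ {j})) :
    univ ×ˢ {j} ⊆ omegaSet (skew φ₁ φ₂) (x, y) := by
  rintro ⟨q, j'⟩ ⟨-, rfl⟩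
  obtain ⟨u, hu, hlim⟩ := mapClusterPt_iff_ultrafilter.1 (hx q)
  set v : Ultrafilter unitInterval :=
    u.map (fun n => fiberWord φ₁ φ₂ (itinerary n x) y) with hv
  have hlim2 : Tendsto (fun n => fiberWord φ₁ φ₂ (itinerary n x) y) u (𝓝 v.lim) :=
    v.le_nhds_lim
  have hmem : (q, v.lim) ∈ omegaSet (skew φ₁ φ₂) (x, y) := by
    refine mapClusterPt_iff_ultrafilter.2 ⟨u, hu, ?_⟩
    simp only [skew_iterate]
    exact hlim.prodMk_nhds hlim2
  have : v.lim = j' := (hxy hmem).2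
  rwa [this] at hmem

theorem isMilnorAttractor_horizontal {c : Bool → NNReal} {δ : ℝ} (hδ : 0 < δ)
    (hpos : ∀ b, 0 < c b) (hlt : c true * c false < 1)
    (hc : ∀ b y, dist y j < δ → dist (cond b φ₁ φ₂ y) j ≤ c b * dist y j)
    (h₁ : φ₁ j = j) (h₂ : φ₂ j = j) :
    IsMilnorAttractor (skew φ₁ φ₂) (univ ×ˢ {j}) where
  nonempty := ⟨(0, j), mem_univ _, rfl⟩
  isCompact := isCompact_univ.prod isCompact_singleton
  invariant := skew_image_horizontal h₁ h₂
  basin_pos := volume_basin_pos hδ hpos hlt hc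
  minimal := by
    intro A' _ hA' heq
    refine (volume_basin_pos hδ hpos hlt hc).ne' ?_
    rw [← measure_congr heq]
    -- A basin point of `A'` over a base orbit accumulating everywhere would force `A'` to contain
    -- the whole line; so the basin of `A'` lies over a null set.
    refine measure_mono_null (t := {x : unitInterval |
      ¬ ∀ q, MapClusterPt q atTop (fun n : ℕ => doubling^[n] x)} ×ˢ univ) ?_ ?_
    · rintro ⟨x, y⟩ hxy
      refine ⟨fun hx => hA'.2 ?_, mem_univ _⟩
      exact (subset_omegaSet hx fun q hq => hA'.1 (hxy hq)).trans hxy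
    · rw [Measure.volume_eq_prod, Measure.prod_prod, ae_iff.1 ae_forall_mapClusterPt_doubling,
        zero_mul]

/-! ### Local riddling -/

/-- If the orbit stayed within `s`, it would remain in a compact annulus inside the region of strict
expansion. There the gain in distance has a positive minimum `κ`, so the distance would grow
linearly without bound. -/
theorem exists_iterate_lt_dist {φ : unitInterval → unitInterval} (hφ : Continuous φ) {r s : ℝ}
    (hsr : s < r) (hexp : ∀ y, 0 < dist y j → dist y j < r → dist y j < dist (φ y) j)
    {y : unitInterval} (hy : 0 < dist y j) : ∃ n, s < dist (φ^[n] y) j := by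
  by_contra! hle
  have hK : IsCompact {z : unitInterval | dist y j ≤ dist z j ∧ dist z j ≤ s} :=
    ((isClosed_le continuous_const (continuous_id.dist continuous_const)).inter
      (isClosed_le (continuous_id.dist continuous_const) continuous_const)).isCompact
  obtain ⟨z, hz, hmin⟩ := hK.exists_isMinOn ⟨y, le_rfl, hle 0⟩
    (f := fun z => dist (φ z) j - dist z j) (by fun_prop)
  set κ := dist (φ z) j - dist z j with hκ
  have hκpos : 0 < κ := sub_pos.2 (hexp z (hy.trans_le hz.1) (hz.2.trans_lt hsr))
  have hgrow (n : ℕ) : dist y j + n * κ ≤ dist (φ^[n] y) j := by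
    induction n with
    | zero => simp
    | succ n ih =>
      have hn : dist y j ≤ dist (φ^[n] y) j := le_trans (by nlinarith [n.cast_nonneg (α := ℝ)]) ih
      have := isMinOn_iff.1 hmin _ ⟨hn, hle n⟩
      rw [Function.iterate_succ_apply']
      push_cast
      linarith
  obtain ⟨n, hn⟩ := Archimedean.arch s hκpos
  rw [nsmul_eq_mul] at hn
  linarith [hgrow n, hle n]

theorem hasLocallyRiddledBasin_horizontal (hφ₁ : Continuous φ₁) (hφ₂ : Continuous φ₂)
    (h₁ : φ₁ j = j) (h₂ : φ₂ j = j) {r : ℝ} (hr : 0 < r)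
    (hexp : ∀ y, 0 < dist y j → dist y j < r → dist y j < dist (φ₂ y) j) :
    HasLocallyRiddledBasin (skew φ₁ φ₂) (univ ×ˢ {j}) := by
  -- Half of `r` leaves room for the closed annulus to stay where `φ₂` strictly expands.
  refine ⟨{p | dist p.2 j < r / 2}, isOpen_lt (by fun_prop) continuous_const, ?_, ?_⟩
  · rintro ⟨x, y⟩ ⟨-, rfl⟩
    simpa using hr
  rintro ⟨x, j'⟩ ⟨-, rfl⟩ ε hε
  obtain ⟨w, -, hw⟩ := exists_cylinder_subset (Metric.ball_mem_nhds x hε)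
  obtain ⟨y, hyball, hyne⟩ : ∃ y, y ∈ Metric.ball j' ε ∧ y ≠ j' := by
    have : ∀ᶠ y in 𝓝[≠] j', y ∈ Metric.ball j' ε ∧ y ≠ j' :=
      (eventually_nhdsWithin_of_eventually_nhds (Metric.ball_mem_nhds j' hε)).and
        self_mem_nhdsWithin
    exact this.exists
  have hne : fiberWord φ₁ φ₂ w y ≠ j' := fun h =>
    hyne (injective_fiberWord w (h.trans (fiberWord_fixed h₁ h₂ w).symm))
  obtain ⟨n, hn⟩ := exists_iterate_lt_dist hφ₂ (half_lt_self hr) hexp (dist_pos.2 hne)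
  -- The prefix `w` keeps the base point in the given ball; the `n` further digits apply `φ₂`
  -- repeatedly until the height escapes.
  set v := w ++ List.replicate n false with hv
  rw [← fiberWord_replicate_false (φ₁ := φ₁), ← fiberWord_append, ← hv] at hn
  set V := Metric.ball j' ε ∩ {z | r / 2 < dist (fiberWord φ₁ φ₂ v z) j'} with hV
  have hVnhds : V ∈ 𝓝 y := by
    have hcont := continuous_fiberWord hφ₁ hφ₂ v
    exact (Metric.isOpen_ball.inter (isOpen_lt continuous_const
      (hcont.dist continuous_const))).mem_nhds ⟨hyball, hn⟩
  have hsub : cylinder v ×ˢ V ⊆ Metric.ball (x, j') ε ∩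
      (⋂ n : ℕ, (skew φ₁ φ₂)^[n] ⁻¹' {p | dist p.2 j' < r / 2})ᶜ := by
    rintro ⟨a, z⟩ ⟨ha, hz, hzr⟩
    refine ⟨?_, fun h => ?_⟩
    · rw [← ball_prod_same]
      exact ⟨hw (cylinder_append_subset _ _ ha), hz⟩
    · have := mem_iInter.1 h v.length
      rw [mem_preimage, skew_iterate_of_mem_cylinder ha] at this
      exact lt_asymm (mem_ofPred.1 this) hzr
  refine lt_of_lt_of_le ?_ (measure_mono hsub)
  rw [Measure.volume_eq_prod, Measure.prod_prod]
  exact ENNReal.mul_pos (volume_cylinder_pos v).ne' (volume_pos_of_mem_nhds hVnhds).ne'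

/-! ### Fiber maps near a fixed point -/

theorem IsC2Diffeo.continuous {φ : unitInterval ≃ unitInterval} (h : IsC2Diffeo φ) :
    Continuous φ := by
  refine Continuous.subtype_mk (f := fun y => (φ y : ℝ)) ?_ (fun y => (φ y).2)
  have := h.1.continuousOn.comp_continuous continuous_subtype_val (fun y : unitInterval => y.2)
  exact this.congr fun y => IccExtend_val (zero_le_one' ℝ) (fun z => (φ z : ℝ)) y

theorem IsC2Diffeo.exists_dist_le {φ : unitInterval ≃ unitInterval} (h : IsC2Diffeo φ)
    {j : unitInterval} (hj : φ j = j) {c : ℝ} (hc : |fiberDeriv φ j| < c) :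
    ∃ δ > 0, ∀ y, dist y j < δ → dist (φ y) j ≤ c * dist y j := by
  have hder : HasDerivWithinAt (realExt φ) (fiberDeriv φ j) (Icc 0 1) j :=
    ((h.1.differentiableOn (by norm_num)) j j.2).hasDerivWithinAt
  -- The gap `c - |φ'(j)|` serves as the constant absorbing the first-order remainder.
  have hlittle := (hasDerivWithinAt_iff_isLittleO.1 hder).def (sub_pos.2 hc)
  rw [eventually_nhdsWithin_iff, Metric.eventually_nhds_iff] at hlittle
  obtain ⟨δ, hδ, hball⟩ := hlittle
  refine ⟨δ, hδ, fun y hy => ?_⟩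
  have hb := hball hy y.2
  simp only [realExt, IccExtend_val, hj, smul_eq_mul, Real.norm_eq_abs] at hb
  rw [Subtype.dist_eq, Subtype.dist_eq, Real.dist_eq, Real.dist_eq]
  have htri := abs_add_le ((φ y : ℝ) - j - (y - j) * fiberDeriv φ j) ((y - j) * fiberDeriv φ j)
  rw [sub_add_cancel, abs_mul] at htri
  linarith

theorem exists_add_mul_add_lt_one {a b : ℝ} (h : a * b < 1) :
    ∃ ε > 0, (a + ε) * (b + ε) < 1 := by
  have hcont : Continuous fun ε : ℝ => (a + ε) * (b + ε) := by fun_prop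
  have h0 : ∀ᶠ ε in 𝓝[>] (0 : ℝ), (a + ε) * (b + ε) < 1 :=
    eventually_nhdsWithin_of_eventually_nhds
      ((hcont.tendsto 0).eventually_lt_const (by simpa using h))
  obtain ⟨ε, h1, h2⟩ := (h0.and self_mem_nhdsWithin).exists
  exact ⟨ε, h2, h1⟩

/-- A horizontal boundary with negative normal Lyapunov exponent, repelling under the second fiber
map, is a Milnor attractor with locally riddled basin. -/
theorem attractor_and_riddled {φ₁ φ₂ : unitInterval ≃ unitInterval} {j : unitInterval}
    (hd₁ : IsC2Diffeo φ₁) (hd₂ : IsC2Diffeo φ₂) (h₁ : φ₁ j = j) (h₂ : φ₂ j = j)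
    (hlog : Real.log (fiberDeriv φ₁ j * fiberDeriv φ₂ j) < 0) {r : ℝ} (hr : 0 < r)
    (hexp : ∀ y, 0 < dist y j → dist y j < r → dist y j < dist (φ₂ y) j) :
    IsMilnorAttractor (skew φ₁ φ₂) (univ ×ˢ {j}) ∧
      HasLocallyRiddledBasin (skew φ₁ φ₂) (univ ×ˢ {j}) := by
  refine ⟨?_, hasLocallyRiddledBasin_horizontal hd₁.continuous hd₂.continuous h₁ h₂ hr hexp⟩
  -- `Real.log` is even and vanishes at 0, so its negativity bounds only the absolute value, and
  -- nonvanishing derivatives are not needed: adding `ε` below makes both constants positive.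
  have hlt : |fiberDeriv φ₁ j| * |fiberDeriv φ₂ j| < 1 := by
    rw [← abs_mul]
    by_contra! hge
    rw [← Real.log_abs] at hlog
    exact absurd hlog (not_lt.2 (Real.log_nonneg hge))
  obtain ⟨ε, hε, hprod⟩ := exists_add_mul_add_lt_one hlt
  obtain ⟨δ₁, hδ₁, hc₁⟩ := hd₁.exists_dist_le h₁ (lt_add_of_pos_right _ hε)
  obtain ⟨δ₂, hδ₂, hc₂⟩ := hd₂.exists_dist_le h₂ (lt_add_of_pos_right _ hε)
  have hp₁ : 0 < |fiberDeriv φ₁ j| + ε := by positivity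
  have hp₂ : 0 < |fiberDeriv φ₂ j| + ε := by positivity
  refine isMilnorAttractor_horizontal
    (c := fun b => cond b ⟨|fiberDeriv φ₁ j| + ε, hp₁.le⟩ ⟨|fiberDeriv φ₂ j| + ε, hp₂.le⟩)
    (lt_min hδ₁ hδ₂) ?_ ?_ ?_ h₁ h₂
  · rintro (_ | _)
    · exact hp₂
    · exact hp₁
  · exact hprod
  · rintro (_ | _) y hy
    · exact hc₂ y (hy.trans_le (min_le_right _ _))
    · exact hc₁ y (hy.trans_le (min_le_left _ _))

theorem log_alpha_zero_neg {g₁ g₂ : ℝ → unitInterval ≃ unitInterval} {β₁ β₂ : ℝ}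
    (hβ₂ : β₂ ∈ Ioo (0 : ℝ) 1) (h : β₂ < xi g₁ g₂ β₁) :
    Real.log (alpha g₁ g₂ 0 β₁ β₂) < 0 := by
  have hne : {t : ℝ | t ∈ Icc (0 : ℝ) 1 ∧
      ∀ b ∈ Ioo (0 : ℝ) 1, b < t → Real.log (alpha g₁ g₂ 0 β₁ b) < 0}.Nonempty :=
    -- The value `t = 0` qualifies vacuously.
    ⟨0, ⟨le_rfl, zero_le_one⟩, fun b hb hb0 => absurd hb.1 (not_lt.2 hb0.le)⟩
  obtain ⟨t, ht, hlt⟩ := exists_lt_of_lt_csSup hne h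
  exact ht.2 β₂ hβ₂ hlt

theorem log_alpha_one_neg {g₁ g₂ : ℝ → unitInterval ≃ unitInterval} {β₁ β₂ : ℝ}
    (hβ₂ : β₂ ∈ Ioo (0 : ℝ) 1) (h : zeta g₁ g₂ β₁ < β₂) :
    Real.log (alpha g₁ g₂ 1 β₁ β₂) < 0 := by
  have hne : {t : ℝ | t ∈ Icc (0 : ℝ) 1 ∧
      ∀ b ∈ Ioo (0 : ℝ) 1, t < b → Real.log (alpha g₁ g₂ 1 β₁ b) < 0}.Nonempty :=
    ⟨1, ⟨zero_le_one, le_rfl⟩, fun b hb hb1 => absurd hb.2 (not_lt.2 hb1.le)⟩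
  obtain ⟨t, ht, hlt⟩ := exists_lt_of_csInf_lt hne h
  exact ht.2 β₂ hβ₂ hlt

theorem dist_zero_eq (y : unitInterval) : dist y 0 = (y : ℝ) := by
  simp [Subtype.dist_eq, abs_of_nonneg y.2.1]

theorem dist_one_eq (y : unitInterval) : dist y 1 = 1 - (y : ℝ) := by
  rw [Subtype.dist_eq, Real.dist_eq, abs_sub_comm]
  exact abs_of_nonneg (sub_nonneg.2 y.2.2)

end RiddledSkew

theorem corollary3p7
    (g₁ g₂ : ℝ → unitInterval ≃ unitInterval)
    (hg₁ : ∀ β ∈ Set.Ioo (0 : ℝ) 1, RiddledSkew.IsFirstFiber β (g₁ β))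
    (hg₂ : ∀ β ∈ Set.Ioo (0 : ℝ) 1, RiddledSkew.IsSecondFiber β (g₂ β))
    (β₁ β₂ : ℝ) (hβ : (β₁, β₂) ∈ RiddledSkew.GammaG g₁ g₂) :
    (RiddledSkew.IsMilnorAttractor (RiddledSkew.skew (g₁ β₁) (g₂ β₂)) RiddledSkew.A₀ ∧
      RiddledSkew.HasLocallyRiddledBasin (RiddledSkew.skew (g₁ β₁) (g₂ β₂)) RiddledSkew.A₀) ∧
    (RiddledSkew.IsMilnorAttractor (RiddledSkew.skew (g₁ β₁) (g₂ β₂)) RiddledSkew.A₁ ∧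
      RiddledSkew.HasLocallyRiddledBasin (RiddledSkew.skew (g₁ β₁) (g₂ β₂)) RiddledSkew.A₁) := by
  obtain ⟨hβ₁, hβ₂, hζ, hξ⟩ := hβ
  have F₁ := hg₁ β₁ hβ₁
  have F₂ := hg₂ β₂ hβ₂
  -- The second fiber map pushes `(0, β₂)` away from 0 and `(β₂, 1)` away from 1, so the repelling
  -- radii are `β₂` and `1 - β₂`.
  refine ⟨RiddledSkew.attractor_and_riddled F₁.diffeo F₂.diffeo F₁.map_zero F₂.map_zero
    (RiddledSkew.log_alpha_zero_neg hβ₂ hξ) hβ₂.1 fun y hy hyr => ?_,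
    RiddledSkew.attractor_and_riddled F₁.diffeo F₂.diffeo F₁.map_one F₂.map_one
    (RiddledSkew.log_alpha_one_neg hβ₂ hζ) (sub_pos.2 hβ₂.2) fun y hy hyr => ?_⟩
  · rw [RiddledSkew.dist_zero_eq] at hy hyr ⊢
    rw [RiddledSkew.dist_zero_eq]
    exact F₂.above y hy hyr
  · rw [RiddledSkew.dist_one_eq] at hy hyr ⊢
    rw [RiddledSkew.dist_one_eq]
    have : ((g₂ β₂ y : unitInterval) : ℝ) < y :=
      F₂.below y ((sub_lt_sub_iff_left _).1 hyr) (sub_pos.1 hy)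
    linarith
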